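/- For $n\ge 0$ let $C_n=(\mathbb Z/2)^n\rtimes \mathfrak S_n$ be the group of signed permutations of $n$ coordinates (the symmetry group of the $n$-cube), let $D_n\le C_n$ be the subgroup of signed permutations with an even number of coordinate inversions, and let $A_n=\mathfrak S_{n+1}$ (the symmetry group of the $n$-simplex). For a finite group $G$ with centre $Z(G)$, let $$\mathbb P_{\varphi\in\mathrm{End}(G)}\big[Z(G)\subseteq\ker\varphi\big]=\frac{|\{\varphi\in\mathrm{End}(G): Z(G)\subseteq\ker\varphi\}|}{|\mathrm{End}(G)|}$$ be the probability that $Z(G)$ lies in the kernel of a uniformly random group endomorphism of $G$. Then $$\lim_{n\to\infty}\mathbb P_{\varphi\in\mathrm{End}(W_n)}\big[Z(W_n)\subseteq\ker\varphi\big]=\begin{cases}\tfrac12 & \text{if } W_n=C_n \text{ (all } n) \text{ or } W_n=D_{2n},\\ 1 & \text{if } W_n=D_{2n+1} \text{ or } W_n=A_n.\end{cases}$$ Moreover, the centre of $D_{2n+1}$ is trivial for $n\ge1$ and the centre of $A_n$ is trivial for $n\ge2$. -/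

import Mathlib

open Filter Topology

/-- The reflection group of type `C_n`, as the group `(C₂)ⁿ ⋊ S_n` of signed permutations of `n`
coordinates (the symmetry group of the `n`-cube). The element `⟨x, σ⟩` acts on `ℝⁿ` by
`e_i ↦ x_{σ i} e_{σ i}`; the symmetric group acts on sign vectors by permuting coordinates. -/
abbrev TypeC (n : ℕ) : Type :=
  (Fin n → ℤˣ) ⋊[(mulAutArrow : Equiv.Perm (Fin n) →* MulAut (Fin n → ℤˣ))] Equiv.Perm (Fin n)

/-- The homomorphism `⟨x, σ⟩ ↦ ∏ i, x i = (-1) ^ (number of coordinate inversions)`. -/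
def inversionSign (n : ℕ) : TypeC n →* ℤˣ where
  toFun w := ∏ i, w.left i
  map_one' := by simp
  map_mul' v w := by
    have h : ∏ i, w.left (v.right⁻¹ • i) = ∏ i, w.left i :=
      Equiv.prod_comp (v.right⁻¹ : Equiv.Perm (Fin n)) w.left
    simp only [SemidirectProduct.mul_left, Pi.mul_apply, Finset.prod_mul_distrib]
    exact congrArg _ h

/-- The reflection group of type `D_n`: the signed permutations of `n` coordinates with an even
number of coordinate inversions. -/
abbrev TypeD (n : ℕ) : Type := (inversionSign n).ker

/-- The reflection group of type `A_n`: the symmetric group on `n + 1` letters (the symmetry group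
of the `n`-simplex). -/
abbrev TypeA (n : ℕ) : Type := Equiv.Perm (Fin (n + 1))

instance (n : ℕ) : Finite (TypeC n) := Finite.of_equiv _ SemidirectProduct.equivProd.symm

/-- The probability that the centre of the finite group `G` is contained in the kernel of an
endomorphism of `G` drawn uniformly at random. -/
noncomputable def probCenterLeKer (G : Type) [Group G] [Finite G] : ℝ :=
  (Nat.card {φ : G →* G // Subgroup.center G ≤ φ.ker} : ℝ) / (Nat.card (G →* G) : ℝ)

section CommutingInvolutions

variable {α : Type*} [Fintype α] [DecidableEq α]

/-- Pairs of commuting permutations of order dividing two which fix every point outside `s`. -/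
def commInvolPairs (s : Finset α) : Finset (Equiv.Perm α × Equiv.Perm α) :=
  {p | p.1 * p.1 = 1 ∧ p.2 * p.2 = 1 ∧ p.1 * p.2 = p.2 * p.1 ∧ ∀ u ∉ s, p.1 u = u ∧ p.2 u = u}

theorem mem_commInvolPairs {s : Finset α} {p : Equiv.Perm α × Equiv.Perm α} :
    p ∈ commInvolPairs s ↔ (∀ u, p.1 (p.1 u) = u) ∧ (∀ u, p.2 (p.2 u) = u) ∧
      (∀ u, p.1 (p.2 u) = p.2 (p.1 u)) ∧ ∀ u ∉ s, p.1 u = u ∧ p.2 u = u := by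
  simp [commInvolPairs, Equiv.ext_iff]

/-- The permutation agreeing with `a` on the `a`-stable set `O` and fixing its complement. -/
theorem exists_perm_eq_on {α : Type*} [DecidableEq α] (a : Equiv.Perm α) (O : Finset α) (h : ∀ u, a u ∈ O ↔ u ∈ O) :
    ∃ p : Equiv.Perm α, (∀ u ∈ O, p u = a u) ∧ ∀ u ∉ O, p u = u := by
  refine ⟨Equiv.Perm.ofSubtype (a.subtypePerm (p := (· ∈ O)) h), fun u hu => ?_, fun u hu => ?_⟩
  · rw [Equiv.Perm.ofSubtype_apply_of_mem _ hu]; rfl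
  · exact Equiv.Perm.ofSubtype_apply_of_not_mem _ hu

theorem card_commInvolPairs_fiber_le {s : Finset α} {p : Equiv.Perm α × Equiv.Perm α}
    (hp : p ∈ commInvolPairs s) (x : α) :
    ({q ∈ commInvolPairs s | (q.1 x, q.2 x, q.1 (q.2 x)) = (p.1 x, p.2 x, p.1 (p.2 x))}).card ≤
      (commInvolPairs (s \ {x, p.1 x, p.2 x, p.1 (p.2 x)})).card := by
  obtain ⟨a, b⟩ := p
  rw [mem_commInvolPairs] at hp
  obtain ⟨ha, hb, hab, -⟩ := hp
  dsimp only at *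
  set O : Finset α := {x, a x, b x, a (b x)} with hO
  have hmem : ∀ u, u ∈ O ↔ u = x ∨ u = a x ∨ u = b x ∨ u = a (b x) := by simp [hO]
  have aO : ∀ u ∈ O, a u ∈ O := by
    intro u hu
    rw [hmem] at hu ⊢
    rcases hu with rfl | rfl | rfl | rfl <;> simp [ha]
  have bO : ∀ u ∈ O, b u ∈ O := by
    intro u hu
    rw [hmem] at hu ⊢
    rcases hu with rfl | rfl | rfl | rfl <;> simp [hb, hab]
  obtain ⟨p, hp, hp'⟩ := exists_perm_eq_on a O
    fun u => ⟨fun h => by simpa [ha] using aO _ h, aO u⟩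
  obtain ⟨q, hq, hq'⟩ := exists_perm_eq_on b O
    fun u => ⟨fun h => by simpa [hb] using bO _ h, bO u⟩
  refine Finset.card_le_card_of_injOn (fun c => (c.1 * p, c.2 * q)) ?_ ?_
  · rintro ⟨c, d⟩ hcd
    simp only [Finset.coe_filter, Set.mem_ofPred_eq, mem_commInvolPairs, Prod.mk.injEq] at hcd
    obtain ⟨⟨hc, hd, hcd, hs⟩, h1, h2, h3⟩ := hcd
    have hcO : ∀ u ∈ O, c u = a u := by
      intro u hu
      rw [hmem] at hu
      rcases hu with rfl | rfl | rfl | rfl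
      · exact h1
      · rw [ha, ← h1, hc]
      · rw [← h3, h2]
      · rw [ha, ← h3, hc, h2]
    have hdO : ∀ u ∈ O, d u = b u := by
      intro u hu
      rw [hmem] at hu
      rcases hu with rfl | rfl | rfl | rfl
      · exact h2
      · rw [← h1, ← hcd, h3, h1, hab]
      · rw [hb, ← h2, hd]
      · have : d (a (b x)) = a x := by rw [← h3, hcd, hd, h1]
        rw [this, hab, hb]
    have cO : ∀ u ∉ O, c u ∉ O := fun u hu h => hu <| by
      have := aO _ h
      rwa [← hcO _ h, hc] at this
    have dO : ∀ u ∉ O, d u ∉ O := fun u hu h => hu <| by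
      have := bO _ h
      rwa [← hdO _ h, hd] at this
    have e1 : ∀ u ∈ O, c (p u) = u := fun u hu => by rw [hp u hu, hcO _ (aO u hu), ha]
    have e2 : ∀ u ∈ O, d (q u) = u := fun u hu => by rw [hq u hu, hdO _ (bO u hu), hb]
    have e3 : ∀ u ∉ O, c (p u) = c u := fun u hu => by rw [hp' u hu]
    have e4 : ∀ u ∉ O, d (q u) = d u := fun u hu => by rw [hq' u hu]
    simp only [Finset.mem_coe, mem_commInvolPairs, Equiv.Perm.mul_apply]
    refine ⟨fun u => ?_, fun u => ?_, fun u => ?_, fun u hu => ?_⟩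
    · by_cases h : u ∈ O
      · rw [e1 u h, e1 u h]
      · rw [e3 u h, e3 _ (cO u h), hc]
    · by_cases h : u ∈ O
      · rw [e2 u h, e2 u h]
      · rw [e4 u h, e4 _ (dO u h), hd]
    · by_cases h : u ∈ O
      · rw [e2 u h, e1 u h, e2 u h]
      · rw [e4 u h, e3 _ (dO u h), e3 u h, e4 _ (cO u h), hcd]
    · by_cases h : u ∈ O
      · exact ⟨e1 u h, e2 u h⟩
      · rw [e3 u h, e4 u h]
        exact hs u fun h' => hu (Finset.mem_sdiff.2 ⟨h', h⟩)
  · rintro ⟨c, d⟩ - ⟨c', d'⟩ - h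
    simpa using h

theorem card_commInvolPairs_fiber_mul_pow_le {s : Finset α} {L : ℕ} (hL : 1 ≤ L)
    (ih : ∀ t : Finset α, t.card < s.card → (commInvolPairs t).card ≤ L ^ t.card)
    {p : Equiv.Perm α × Equiv.Perm α} (hp : p ∈ commInvolPairs s) {x : α} (hx : x ∈ s) {k : ℕ}
    (hk : k ≤ ({x, p.1 x, p.2 x, p.1 (p.2 x)} : Finset α).card) :
    ({q ∈ commInvolPairs s | (q.1 x, q.2 x, q.1 (q.2 x)) = (p.1 x, p.2 x, p.1 (p.2 x))}).card
      * L ^ k ≤ L ^ s.card := by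
  set O : Finset α := {x, p.1 x, p.2 x, p.1 (p.2 x)} with hO
  obtain ⟨h1, h2, -, hs⟩ := mem_commInvolPairs.1 hp
  have m1 : ∀ u ∈ s, p.1 u ∈ s := fun u hu => by
    by_contra h
    have := (hs _ h).1
    rw [h1] at this
    exact h (this ▸ hu)
  have m2 : ∀ u ∈ s, p.2 u ∈ s := fun u hu => by
    by_contra h
    have := (hs _ h).2
    rw [h2] at this
    exact h (this ▸ hu)
  have hOs : O ⊆ s := by
    intro u hu
    simp only [hO, Finset.mem_insert, Finset.mem_singleton] at hu
    rcases hu with rfl | rfl | rfl | rfl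
    exacts [hx, m1 _ hx, m2 _ hx, m1 _ (m2 _ hx)]
  have hcard := Finset.card_sdiff_add_card_eq_card hOs
  have hpos : 0 < O.card := Finset.card_pos.2 ⟨x, by simp [hO]⟩
  calc _ ≤ L ^ (s \ O).card * L ^ O.card :=
        Nat.mul_le_mul ((card_commInvolPairs_fiber_le hp x).trans (ih _ (by rw [← hO]; omega)))
          (Nat.pow_le_pow_right hL hk)
    _ = L ^ s.card := by rw [← pow_add, hcard]

theorem card_commInvolPairs_le {L : ℕ} (hL : 1 ≤ L)
    (h : L ^ 3 + 3 * Fintype.card α * L ^ 2 + Fintype.card α ^ 3 ≤ L ^ 4) (s : Finset α) :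
    (commInvolPairs s).card ≤ L ^ s.card := by
  induction hm : s.card using Nat.strong_induction_on generalizing s with
  | _ m ih =>
  subst hm
  replace ih : ∀ t : Finset α, t.card < s.card → (commInvolPairs t).card ≤ L ^ t.card :=
    fun t ht => ih _ ht t rfl
  obtain rfl | ⟨x, hx⟩ := s.eq_empty_or_nonempty
  · rw [Finset.card_empty, pow_zero, Finset.card_le_one]
    have key : ∀ p ∈ commInvolPairs (∅ : Finset α), p = 1 := fun p hp => by
      obtain ⟨-, -, -, hs⟩ := mem_commInvolPairs.1 hp
      ext u
      exacts [(hs u (by simp)).1, (hs u (by simp)).2]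
    intro p hp q hq
    rw [key p hp, key q hq]
  · set N := Fintype.card α
    set P := commInvolPairs s with hP
    let f : Equiv.Perm α × Equiv.Perm α → α × α × α := fun q => (q.1 x, q.2 x, q.1 (q.2 x))
    have key : ∀ (k : ℕ) (K : Finset (α × α × α)),
        (∀ p ∈ P, f p ∈ K → k ≤ ({x, p.1 x, p.2 x, p.1 (p.2 x)} : Finset α).card) →
        ({p ∈ P | f p ∈ K}).card * L ^ k ≤ L ^ s.card * K.card := by
      intro k K hK
      rw [Finset.card_eq_sum_card_fiberwise (f := f) (t := K) (fun p hp => by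
        simpa using (Finset.mem_filter.1 hp).2), Finset.sum_mul, mul_comm, ← smul_eq_mul]
      refine Finset.sum_le_card_nsmul _ _ _ fun y hy => ?_
      by_cases hne : ∃ p ∈ P, f p = y
      · obtain ⟨p, hp, rfl⟩ := hne
        refine le_trans (Nat.mul_le_mul_right _ (Finset.card_le_card ?_))
          (card_commInvolPairs_fiber_mul_pow_le hL ih hp hx (hK p hp hy))
        intro q hq
        simp only [Finset.mem_filter] at hq ⊢
        exact ⟨hq.1.1, hq.2⟩
      · rw [Finset.card_eq_zero.2, zero_mul]
        · exact Nat.zero_le _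
        · rw [Finset.filter_eq_empty_iff]
          exact fun q hq hqy => hne ⟨q, (Finset.mem_filter.1 hq).1, hqy⟩
    let K0 : Finset (α × α × α) := {(x, x, x)}
    let K1 : Finset (α × α × α) := (Finset.univ.erase x).image fun y => (x, y, y)
    let K2 : Finset (α × α × α) := (Finset.univ.erase x).image fun y => (y, x, y)
    let K3 : Finset (α × α × α) := (Finset.univ.erase x).image fun y => (y, y, x)
    let K4 : Finset (α × α × α) := {y | ({x, y.1, y.2.1, y.2.2} : Finset α).card = 4}
    have c0 : K0.card = 1 := rfl
    have cE : (Finset.univ.erase x).card ≤ N := (Finset.card_le_univ _)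
    have c1 : K1.card ≤ N := Finset.card_image_le.trans cE
    have c2 : K2.card ≤ N := Finset.card_image_le.trans cE
    have c3 : K3.card ≤ N := Finset.card_image_le.trans cE
    have c4 : K4.card ≤ N ^ 3 := (Finset.card_le_univ _).trans (by
      simp only [Fintype.card_prod]; exact le_of_eq (by ring))
    have two : ∀ {S : Finset α} (y : α), y ≠ x → x ∈ S → y ∈ S → 2 ≤ S.card := fun y hy h1 h2 =>
      Finset.one_lt_card.2 ⟨x, h1, y, h2, hy.symm⟩
    have b0 := key 1 K0 fun p _ _ => Finset.card_pos.2 ⟨x, by simp⟩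
    have b1 := key 2 K1 fun p _ hp => by
      obtain ⟨y, hy, hyp⟩ := Finset.mem_image.1 hp
      simp only [f, Prod.mk.injEq] at hyp
      exact two y (by simpa using hy) (by simp) (by simp [hyp.2.1])
    have b2 := key 2 K2 fun p _ hp => by
      obtain ⟨y, hy, hyp⟩ := Finset.mem_image.1 hp
      simp only [f, Prod.mk.injEq] at hyp
      exact two y (by simpa using hy) (by simp) (by simp [hyp.1])
    have b3 := key 2 K3 fun p _ hp => by
      obtain ⟨y, hy, hyp⟩ := Finset.mem_image.1 hp
      simp only [f, Prod.mk.injEq] at hyp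
      exact two y (by simpa using hy) (by simp) (by simp [hyp.1])
    have b4 := key 4 K4 fun p _ hp => by
      simp only [K4, f, Finset.mem_filter_univ] at hp
      exact hp.ge
    have cover : P ⊆ {p ∈ P | f p ∈ K0} ∪ {p ∈ P | f p ∈ K1} ∪ {p ∈ P | f p ∈ K2} ∪
        {p ∈ P | f p ∈ K3} ∪ {p ∈ P | f p ∈ K4} := by
      intro p hp
      obtain ⟨h1, h2, h3, -⟩ := mem_commInvolPairs.1 hp
      simp only [← Finset.filter_or, Finset.mem_filter, hp, true_and]
      by_cases e1 : p.1 x = x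
      · by_cases e2 : p.2 x = x
        · simp [K0, f, e1, e2]
        · simp [K1, f, e1, h3, e2]
      · by_cases e2 : p.2 x = x
        · simp [K2, f, e1, e2]
        · by_cases e3 : p.1 x = p.2 x
          · simp [K3, f, ← e3, h1, e1]
          · right
            simp only [K4, f, Finset.mem_filter_univ]
            have i1 : p.1 (p.2 x) ≠ x := fun h => e3 (by rw [← h1 (p.2 x), h])
            have i2 : p.1 (p.2 x) ≠ p.1 x := fun h => e2 (p.1.injective h)
            have i3 : p.1 (p.2 x) ≠ p.2 x := fun h => e1 (p.2.injective (by rw [← h3, h]))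
            rw [Finset.card_insert_of_notMem, Finset.card_insert_of_notMem, Finset.card_pair i3.symm]
            · simp [e3, i2.symm]
            · simp [Ne.symm e1, Ne.symm e2, i1.symm]
    have hle : P.card ≤ ({p ∈ P | f p ∈ K0}).card + ({p ∈ P | f p ∈ K1}).card +
        ({p ∈ P | f p ∈ K2}).card + ({p ∈ P | f p ∈ K3}).card + ({p ∈ P | f p ∈ K4}).card := by
      refine (Finset.card_le_card cover).trans ?_
      refine (Finset.card_union_le _ _).trans (Nat.add_le_add_right ?_ _)
      refine (Finset.card_union_le _ _).trans (Nat.add_le_add_right ?_ _)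
      refine (Finset.card_union_le _ _).trans (Nat.add_le_add_right ?_ _)
      exact Finset.card_union_le _ _
    refine Nat.le_of_mul_le_mul_right ?_ (Nat.pow_pos (n := 4) hL)
    set M := L ^ s.card
    calc P.card * L ^ 4 ≤ _ := Nat.mul_le_mul_right _ hle
      _ = (({p ∈ P | f p ∈ K0}).card * L ^ 1) * L ^ 3 + (({p ∈ P | f p ∈ K1}).card * L ^ 2) * L ^ 2
        + (({p ∈ P | f p ∈ K2}).card * L ^ 2) * L ^ 2 + (({p ∈ P | f p ∈ K3}).card * L ^ 2) * L ^ 2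
        + ({p ∈ P | f p ∈ K4}).card * L ^ 4 := by ring
      _ ≤ (M * 1) * L ^ 3 + (M * N) * L ^ 2 + (M * N) * L ^ 2 + (M * N) * L ^ 2 + M * N ^ 3 := by
        refine Nat.add_le_add (Nat.add_le_add (Nat.add_le_add (Nat.add_le_add ?_ ?_) ?_) ?_) ?_
        · exact Nat.mul_le_mul_right _ (c0 ▸ b0)
        · exact Nat.mul_le_mul_right _ (b1.trans (Nat.mul_le_mul_left _ c1))
        · exact Nat.mul_le_mul_right _ (b2.trans (Nat.mul_le_mul_left _ c2))
        · exact Nat.mul_le_mul_right _ (b3.trans (Nat.mul_le_mul_left _ c3))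
        · exact b4.trans (Nat.mul_le_mul_left _ c4)
      _ = M * (L ^ 3 + 3 * N * L ^ 2 + N ^ 3) := by ring
      _ ≤ M * L ^ 4 := Nat.mul_le_mul_left _ h

end CommutingInvolutions

section SymmetricGroupEndomorphisms

open Equiv Equiv.Perm

variable {α : Type*} [DecidableEq α]

theorem exists_perm_shift_five {x₀ x₁ x₂ x₃ x₄ : α} (h : [x₀, x₁, x₂, x₃, x₄].Nodup) :
    ∃ g : Perm α, g x₀ = x₁ ∧ g x₁ = x₂ ∧ g x₂ = x₃ ∧ g x₃ = x₄ ∧ g x₄ = x₀ :=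
  ⟨_, List.formPerm_apply_getElem _ h 0 (by simp), List.formPerm_apply_getElem _ h 1 (by simp),
    List.formPerm_apply_getElem _ h 2 (by simp), List.formPerm_apply_getElem _ h 3 (by simp),
    (List.formPerm_apply_getElem _ h 4 (by simp)).trans (by simp)⟩

theorem exists_perm_shift_eight {x₀ x₁ x₂ x₃ x₄ x₅ x₆ x₇ : α}
    (h : [x₀, x₁, x₂, x₃, x₄, x₅, x₆, x₇].Nodup) :
    ∃ g : Perm α, g x₀ = x₁ ∧ g x₁ = x₂ ∧ g x₂ = x₃ ∧ g x₃ = x₄ ∧ g x₄ = x₅ ∧ g x₅ = x₆ ∧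
      g x₆ = x₇ ∧ g x₇ = x₀ :=
  ⟨_, List.formPerm_apply_getElem _ h 0 (by simp), List.formPerm_apply_getElem _ h 1 (by simp),
    List.formPerm_apply_getElem _ h 2 (by simp), List.formPerm_apply_getElem _ h 3 (by simp),
    List.formPerm_apply_getElem _ h 4 (by simp), List.formPerm_apply_getElem _ h 5 (by simp),
    List.formPerm_apply_getElem _ h 6 (by simp), (List.formPerm_apply_getElem _ h 7 (by simp)).trans (by simp)⟩

/-- Transpositions form a class of `3`-transpositions; no other class of involutions does. -/
theorem exists_conj_mul_pow_ne_one [Fintype α] (hα : 7 ≤ Fintype.card α) {t : Perm α}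
    (ht : t * t = 1) (ht1 : t ≠ 1) (hts : ¬ t.IsSwap) :
    ∃ g : Perm α, (t * (g * t * g⁻¹)) ^ 2 ≠ 1 ∧ (t * (g * t * g⁻¹)) ^ 3 ≠ 1 := by
  have htt : ∀ u, t (t u) = u := fun u => by simpa using Perm.ext_iff.1 ht u
  have hconj : ∀ (g : Perm α) {x y x' y' : α}, g x = x' → g y = y' → t x = y →
      (g * t * g⁻¹) x' = y' := by
    rintro g x y _ _ rfl rfl rfl
    simp
  by_cases hfix : ∃ e, t e = e
  · obtain ⟨e, he⟩ := hfix
    obtain ⟨a, ha⟩ : ∃ a, t a ≠ a := by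
      by_contra! h
      exact ht1 (Perm.ext h)
    obtain ⟨c, hc, hca, hcb⟩ : ∃ c, t c ≠ c ∧ c ≠ a ∧ c ≠ t a := by
      by_contra! h
      refine hts ⟨a, t a, ha.symm, Perm.ext fun u => ?_⟩
      by_cases h1 : u = a
      · subst h1; simp
      · by_cases h2 : u = t a
        · subst h2; simp [htt]
        · rw [swap_apply_of_ne_of_ne h1 h2]
          by_contra h3
          exact h2 (h u h3 h1)
    obtain ⟨b, hb⟩ : ∃ b, t a = b := ⟨_, rfl⟩
    obtain ⟨d, hd⟩ : ∃ d, t c = d := ⟨_, rfl⟩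
    have hb' : t b = a := by rw [← hb, htt]
    have hd' : t d = c := by rw [← hd, htt]
    have hnd : [a, b, c, d, e].Nodup := by
      simp only [List.nodup_cons, List.mem_cons, List.not_mem_nil, or_false, not_or, not_false_eq_true,
        List.nodup_nil, and_true]
      grind
    obtain ⟨g, g0, g1, g2, g3, g4⟩ := exists_perm_shift_five hnd
    have wa := hconj g g4 g4 he
    have wb := hconj g g0 g1 hb
    have wd := hconj g g2 g3 hd
    refine ⟨g, fun h => ?_, fun h => ?_⟩
    · have := Perm.ext_iff.1 h a
      simp only [pow_two, Perm.mul_apply _ (g * t * g⁻¹), Perm.mul_apply (t * (g * t * g⁻¹)),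
        wa, hb, wb, hd, Perm.one_apply] at this
      subst this; simp at hnd
    · have := Perm.ext_iff.1 h a
      simp only [pow_three, Perm.mul_apply _ (g * t * g⁻¹),
        Perm.mul_apply (t * (g * t * g⁻¹)), wa, hb, wb, hd, wd, he, Perm.one_apply] at this
      subst this; simp at hnd
  · push Not at hfix
    have pick : ∀ s : Finset α, s.card ≤ 6 → ∃ x, x ∉ s := fun s hs => by
      by_contra! h
      have := Finset.card_le_card (fun x _ => h x : Finset.univ ⊆ s)
      rw [Finset.card_univ] at this
      omega
    obtain ⟨x₀, -⟩ := pick ∅ (by simp)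
    obtain ⟨x₁, h01⟩ : ∃ y, t x₀ = y := ⟨_, rfl⟩
    obtain ⟨x₂, h2⟩ := pick {x₀, x₁} (Finset.card_le_two.trans (by norm_num))
    obtain ⟨x₃, h23⟩ : ∃ y, t x₂ = y := ⟨_, rfl⟩
    obtain ⟨x₄, h4⟩ := pick {x₀, x₁, x₂, x₃} (Finset.card_le_four.trans (by norm_num))
    obtain ⟨x₅, h45⟩ : ∃ y, t x₄ = y := ⟨_, rfl⟩
    obtain ⟨x₆, h6⟩ := pick {x₀, x₁, x₂, x₃, x₄, x₅} Finset.card_le_six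
    obtain ⟨x₇, h67⟩ : ∃ y, t x₆ = y := ⟨_, rfl⟩
    have h10 : t x₁ = x₀ := by rw [← h01, htt]
    have h32 : t x₃ = x₂ := by rw [← h23, htt]
    have h54 : t x₅ = x₄ := by rw [← h45, htt]
    have h76 : t x₇ = x₆ := by rw [← h67, htt]
    simp only [Finset.mem_insert, Finset.mem_singleton, not_or] at h2 h4 h6
    have hnd : [x₀, x₁, x₂, x₃, x₄, x₅, x₆, x₇].Nodup := by
      simp only [List.nodup_cons, List.mem_cons, List.not_mem_nil, or_false, not_or,
        not_false_eq_true, List.nodup_nil, and_true]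
      have n2 := hfix x₀; have n3 := hfix x₂; have n4 := hfix x₄; have n5 := hfix x₆
      clear hfix ht ht1 hts hconj pick hα htt
      constructorm* _ ∧ _ <;> grind only
    obtain ⟨g, g0, g1, g2, g3, g4, g5, g6, g7⟩ := exists_perm_shift_eight hnd
    have w0 := hconj g g7 g6 h76
    have w6 := hconj g g5 g4 h54
    have w4 := hconj g g3 g2 h32
    refine ⟨g, fun h => ?_, fun h => ?_⟩
    · have := Perm.ext_iff.1 h x₀
      simp only [pow_two, Perm.mul_apply _ (g * t * g⁻¹), Perm.mul_apply (t * (g * t * g⁻¹)),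
        w0, h76, w6, h54, Perm.one_apply] at this
      subst this; simp at hnd
    · have := Perm.ext_iff.1 h x₀
      simp only [pow_three, Perm.mul_apply _ (g * t * g⁻¹),
        Perm.mul_apply (t * (g * t * g⁻¹)), w0, h76, w6, h54, w4, h32, Perm.one_apply] at this
      subst this; simp at hnd

theorem exists_swap_of_not_commute {s s' : Perm α} (hs : s.IsSwap) (hs' : s'.IsSwap)
    (h : ¬ Commute s s') :
    ∃ p a b, p ≠ a ∧ p ≠ b ∧ a ≠ b ∧ s = swap p a ∧ s' = swap p b := by
  obtain ⟨x, y, hxy, rfl⟩ := hs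
  obtain ⟨z, w, hzw, rfl⟩ := hs'
  by_cases h1 : x = z
  · subst h1
    refine ⟨x, y, w, hxy, hzw, ?_, rfl, rfl⟩
    rintro rfl; exact h (Commute.refl _)
  by_cases h2 : x = w
  · subst h2
    refine ⟨x, y, z, hxy, hzw.symm, ?_, rfl, swap_comm _ _⟩
    rintro rfl; exact h (by rw [swap_comm])
  by_cases h3 : y = z
  · subst h3
    refine ⟨y, x, w, hxy.symm, hzw, h2, swap_comm _ _, rfl⟩
  by_cases h4 : y = w
  · subst h4
    refine ⟨y, x, z, hxy.symm, hzw.symm, h1, swap_comm _ _, swap_comm _ _⟩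
  exact absurd (Perm.disjoint_iff_eq_or_eq.2 fun u => by
    by_cases hx : u = x
    · subst hx; right; exact swap_apply_of_ne_of_ne h1 h2
    · by_cases hy : u = y
      · subst hy; right; exact swap_apply_of_ne_of_ne h3 h4
      · left; exact swap_apply_of_ne_of_ne hx hy).commute h

theorem swap_mul_swap_pow [Fintype α] {s s' : Perm α} (hs : s.IsSwap) (hs' : s'.IsSwap) :
    (s * s') ^ 2 = 1 ∨ (s * s') ^ 3 = 1 := by
  by_cases h : Commute s s'
  · left
    rw [h.mul_pow]
    obtain ⟨x, y, hxy, rfl⟩ := hs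
    obtain ⟨z, w, hzw, rfl⟩ := hs'
    simp [pow_two]
  · right
    obtain ⟨p, a, b, h1, h2, h3, rfl, rfl⟩ := exists_swap_of_not_commute hs hs' h
    rw [← (isThreeCycle_swap_mul_swap_same h1 h2 h3).orderOf, pow_orderOf_eq_one]

theorem isSwap_map_of_bijective [Fintype α] (hα : 7 ≤ Fintype.card α) {f : Perm α →* Perm α}
    (hf : Function.Bijective f) {s : Perm α} (hs : s.IsSwap) : (f s).IsSwap := by
  by_contra hns
  have hss : s * s = 1 := by obtain ⟨x, y, hxy, rfl⟩ := hs; simp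
  have hs1 : s ≠ 1 := by
    obtain ⟨x, y, hxy, rfl⟩ := hs
    exact fun h => hxy (swap_eq_one_iff.1 h)
  obtain ⟨g, h2, h3⟩ := exists_conj_mul_pow_ne_one hα (t := f s) (by rw [← map_mul, hss, map_one])
    (fun h => hs1 (hf.1 (by rw [h, map_one]))) hns
  obtain ⟨g, rfl⟩ := hf.2 g
  have hs' : (g * s * g⁻¹).IsSwap := by
    obtain ⟨x, y, hxy, rfl⟩ := hs
    exact ⟨g x, g y, g.injective.ne hxy, (swap_apply_apply g x y).symm⟩
  simp only [← map_mul, ← map_inv, ← map_pow] at h2 h3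
  rcases swap_mul_swap_pow hs hs' with h | h
  · exact h2 (by rw [h, map_one])
  · exact h3 (by rw [h, map_one])

theorem monoidHom_perm_ext [Finite α] {G : Type*} [Group G] {f g : Perm α →* G} (x : α)
    (h : ∀ i, f (swap x i) = g (swap x i)) : f = g := by
  refine MonoidHom.eq_of_eqOn_dense (closure_isSwap (α := α)) ?_
  rintro _ ⟨i, j, hij, rfl⟩
  by_cases hi : i = x
  · subst hi; exact h j
  by_cases hj : j = x
  · subst hj; rw [swap_comm]; exact h i
  have : swap i j = swap x i * swap x j * (swap x i)⁻¹ := by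
    rw [← swap_apply_apply, swap_apply_left, swap_apply_of_ne_of_ne hj hij.symm]
  rw [this]
  simp [h]

theorem not_commute_swap_swap {x i j : α} (hi : x ≠ i) (hj : x ≠ j) (hij : i ≠ j) :
    ¬ Commute (swap x i) (swap x j) := fun h => by
  have := Perm.ext_iff.1 h.eq x
  simp only [Perm.mul_apply, swap_apply_left] at this
  rw [swap_apply_of_ne_of_ne hj.symm hij.symm, swap_apply_of_ne_of_ne hi.symm hij] at this
  exact hij this.symm

theorem exists_conj_of_isSwap_map [Fintype α] (hα : 3 ≤ Fintype.card α) {f : Perm α →* Perm α}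
    (hf : Function.Injective f) (hsw : ∀ s : Perm α, s.IsSwap → (f s).IsSwap) :
    ∃ τ : Perm α, ∀ σ, f σ = τ * σ * τ⁻¹ := by
  obtain ⟨x, i, j, hxi, hxj, hij⟩ := Fintype.two_lt_card_iff.1 (show 2 < Fintype.card α from hα)
  have hcomm : ∀ k l, x ≠ k → x ≠ l → k ≠ l → ¬ Commute (f (swap x k)) (f (swap x l)) := by
    intro k l hk hl hkl h
    refine not_commute_swap_swap hk hl hkl (hf ?_)
    simpa using h.eq
  have hS : ∀ k, x ≠ k → (f (swap x k)).IsSwap := fun k hk => hsw _ ⟨x, k, hk, rfl⟩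
  obtain ⟨p, a, b, hpa, hpb, hab, ha, hb⟩ :=
    exists_swap_of_not_commute (hS i hxi) (hS j hxj) (hcomm i j hxi hxj hij)
  have key : ∀ k, ∃ q, (x = k ↔ p = q) ∧ f (swap x k) = swap p q := by
    intro k
    by_cases hk : x = k
    · exact ⟨p, by simp [hk], by simp [hk, swap_self, ← Perm.one_def]⟩
    by_cases hki : k = i
    · exact ⟨a, by simp [hk, hpa], hki ▸ ha⟩
    by_cases hkj : k = j
    · exact ⟨b, by simp [hk, hpb], hkj ▸ hb⟩
    obtain ⟨q, hq, hk'⟩ : ∃ q, p ≠ q ∧ f (swap x k) = swap p q := by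
      obtain ⟨u, v, w, huv, huw, hvw, h1, h2⟩ := exists_swap_of_not_commute (hS k hk) (hS i hxi)
        (hcomm k i hk hxi hki)
      obtain ⟨u', v', w', huv', huw', hvw', h1', h2'⟩ := exists_swap_of_not_commute (hS k hk)
        (hS j hxj) (hcomm k j hk hxj hkj)
      rw [ha] at h2
      rw [hb] at h2'
      have mem : ∀ {r s r' s' : α}, r ≠ s → swap r s = swap r' s' →
          (r = r' ∧ s = s') ∨ (r = s' ∧ s = r') := by
        intro r s r' s' hrs h
        have e := Perm.ext_iff.1 h r
        rw [swap_apply_left] at e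
        by_cases c1 : r = r'
        · subst c1; left; exact ⟨rfl, by rw [e, swap_apply_left]⟩
        · by_cases c2 : r = s'
          · subst c2; right; exact ⟨rfl, by rw [e, swap_apply_right]⟩
          · rw [swap_apply_of_ne_of_ne c1 c2] at e
            exact absurd e.symm hrs
      rcases mem hpa h2 with ⟨e1, e2⟩ | ⟨e1, e2⟩
      · exact ⟨v, e1 ▸ huv, e1 ▸ h1⟩
      rcases mem hpb h2' with ⟨e1', e2'⟩ | ⟨e1', e2'⟩
      · exact ⟨v', e1' ▸ huv', e1' ▸ h1'⟩
      -- the remaining possibility is `f (swap x k) = swap a b`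
      exfalso
      have h3 : f (swap x k) = swap a b := by
        subst e2 e2' e1
        rw [h1]
        rcases mem huv' (h1'.symm.trans h1) with ⟨h, -⟩ | ⟨h, h'⟩
        · exact absurd h.symm hab
        · rw [← h]
      have h4 : f (swap i j) = swap a b := by
        have : swap i j = swap x i * swap x j * (swap x i)⁻¹ := by
          rw [← swap_apply_apply, swap_apply_left, swap_apply_of_ne_of_ne hxj.symm hij.symm]
        rw [this, map_mul, map_mul, map_inv, ha, hb, ← swap_apply_apply, swap_apply_left,
          swap_apply_of_ne_of_ne hpb.symm hab.symm]
      rcases mem hk (hf (h3.trans h4.symm)) with ⟨h, -⟩ | ⟨h, -⟩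
      exacts [hxi h, hxj h]
    exact ⟨q, by simp [hk, hq], hk'⟩
  choose τ hτx hτ using key
  have hx : τ x = p := ((hτx x).1 rfl).symm
  have hinj : Function.Injective τ := by
    intro k l hkl
    have := hf ((hτ k).trans (hkl ▸ (hτ l).symm))
    simpa using Perm.ext_iff.1 this x
  let T : Perm α := Equiv.ofBijective τ (Finite.injective_iff_bijective.1 hinj)
  have : f = (MulAut.conj T).toMonoidHom := by
    refine monoidHom_perm_ext x fun k => ?_
    rw [hτ, ← hx]
    exact swap_apply_apply T x k
  exact ⟨T, fun σ => by rw [this]; rfl⟩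

theorem alternatingGroup_le_ker_or_exists_conj [Fintype α] (hα : 7 ≤ Fintype.card α)
    (f : Perm α →* Perm α) :
    alternatingGroup α ≤ f.ker ∨ ∃ τ : Perm α, ∀ σ, f σ = τ * σ * τ⁻¹ := by
  by_cases hf : Function.Injective f
  · exact Or.inr (exists_conj_of_isSwap_map (by omega) hf fun s hs =>
      isSwap_map_of_bijective hα (Finite.injective_iff_bijective.1 hf) hs)
  · left
    refine alternatingGroup_le_of_normal (by rw [Nat.card_eq_fintype_card]; omega) ?_
    rw [Subgroup.nontrivial_iff_ne_bot]
    exact fun h => hf ((MonoidHom.ker_eq_bot_iff f).1 h)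

theorem perm_eq_one_of_forall_commute [Fintype α] (hα : 3 ≤ Fintype.card α) {τ : Perm α}
    (h : ∀ σ : Perm α, τ * σ = σ * τ) : τ = 1 := by
  ext x
  by_contra hx
  obtain ⟨y, hy⟩ : ∃ y, y ∉ ({x, τ x} : Finset α) := by
    by_contra! h
    have h1 := Finset.card_le_card (fun x _ => h x : Finset.univ ⊆ _)
    have h2 := Finset.card_le_two (a := x) (b := τ x)
    rw [Finset.card_univ] at h1
    omega
  simp only [Finset.mem_insert, Finset.mem_singleton, not_or] at hy
  have := Perm.ext_iff.1 (h (swap x y)) x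
  simp only [Perm.mul_apply, swap_apply_left] at this
  exact hy.1 (τ.injective (this.trans (swap_apply_of_ne_of_ne hx (Ne.symm hy.2))))

end SymmetricGroupEndomorphisms

section SignedPermutations

open SemidirectProduct Equiv Equiv.Perm

variable {n : ℕ}

theorem TypeC.mul_left_apply (v w : TypeC n) (i : Fin n) :
    (v * w).left i = v.left i * w.left (v.right⁻¹ i) := rfl

theorem TypeC.mul_right (v w : TypeC n) : (v * w).right = v.right * w.right := rfl

theorem TypeC.ext' {v w : TypeC n} (hl : ∀ i, v.left i = w.left i) (hr : v.right = w.right) :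
    v = w := SemidirectProduct.ext (funext hl) hr

theorem TypeC.mul_self_of_right_eq_one {v : TypeC n} (hv : v.right = 1) : v * v = 1 := by
  refine TypeC.ext' (fun i => ?_) ?_
  · rw [TypeC.mul_left_apply, hv]
    exact Int.units_mul_self _
  · rw [TypeC.mul_right, hv]; rfl

theorem TypeC.left_conj_inr (σ : Perm (Fin n)) (v : Fin n → ℤˣ) :
    (inr σ * inl v * (inr σ)⁻¹ : TypeC n) = inl fun i => v (σ⁻¹ i) := by
  rw [← map_inv, ← inl_aut]; rfl

/-- The central symmetry `-1` of the cube. -/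
def centralInversion (n : ℕ) : TypeC n := inl fun _ => -1

theorem centralInversion_mul_comm (w : TypeC n) :
    centralInversion n * w = w * centralInversion n := by
  refine TypeC.ext' (fun i => ?_) ?_
  · rw [TypeC.mul_left_apply, TypeC.mul_left_apply]
    exact mul_comm _ _
  · simp [centralInversion]

theorem centralInversion_ne_one (hn : 0 < n) : centralInversion n ≠ 1 := fun h => by
  have := congrFun (congrArg SemidirectProduct.left h) ⟨0, hn⟩
  have h' : (-1 : ℤˣ) = 1 := this
  exact absurd h' (by decide)

theorem TypeC.eq_one_or_eq_centralInversion {x : TypeC n} (hx : x.right = 1)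
    (h : ∀ σ : Perm (Fin n), ∃ w : TypeC n, w.right = σ ∧ w * x = x * w) :
    x = 1 ∨ x = centralInversion n := by
  have hconst : ∀ i j, x.left i = x.left j := by
    intro i j
    obtain ⟨w, hw, hwx⟩ := h (swap i j)
    have := congrFun (congrArg SemidirectProduct.left hwx) i
    rw [TypeC.mul_left_apply, TypeC.mul_left_apply, hx, hw, mul_comm, swap_inv,
      swap_apply_left, inv_one, Perm.one_apply] at this
    exact (mul_right_cancel this).symm
  rcases n.eq_zero_or_pos with rfl | hn
  · exact Or.inl (TypeC.ext' (fun i => i.elim0) hx)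
  · rcases Int.units_eq_one_or (x.left ⟨0, hn⟩) with h0 | h0
    · exact Or.inl (TypeC.ext' (fun i => (hconst i _).trans h0) hx)
    · exact Or.inr (TypeC.ext' (fun i => (hconst i _).trans h0) hx)

theorem TypeC.eq_of_mem_center {H : Subgroup (TypeC n)} (hn : 3 ≤ n) (hS : ∀ σ, inr σ ∈ H) {x : H}
    (hx : x ∈ Subgroup.center H) : (x : TypeC n) = 1 ∨ (x : TypeC n) = centralInversion n := by
  have hcomm : ∀ σ : Perm (Fin n), (inr σ : TypeC n) * (x : TypeC n) = (x : TypeC n) * inr σ := fun σ =>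
    congrArg Subtype.val (Subgroup.mem_center_iff.1 hx ⟨inr σ, hS σ⟩)
  refine TypeC.eq_one_or_eq_centralInversion ?_ fun σ => ⟨inr σ, rfl, hcomm σ⟩
  refine perm_eq_one_of_forall_commute (by simpa using hn) fun σ => ?_
  exact (congrArg SemidirectProduct.right (hcomm σ)).symm

instance (H : Subgroup (TypeC n)) : Finite (H →* H) := DFunLike.finite _

/-- Endomorphisms which induce an inner automorphism on the quotient permutation group. -/
def IsPermInner {H : Subgroup (TypeC n)} (φ : H →* H) : Prop :=
  ∃ τ : Perm (Fin n), ∀ w : H, (φ w : TypeC n).right = τ * (w : TypeC n).right * τ⁻¹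

/-- Multiplying an endomorphism by the `τ`-translate of the sign vector of the argument. -/
def signTwist {H : Subgroup (TypeC n)} (hS : ∀ σ, inr σ ∈ H) (φ : H →* H) (τ : Perm (Fin n))
    (hτ : ∀ w : H, (φ w : TypeC n).right = τ * (w : TypeC n).right * τ⁻¹) : H →* H :=
  MonoidHom.mk' (fun w => ⟨⟨fun i => (w : TypeC n).left (τ⁻¹ i) * (φ w : TypeC n).left i,
      (φ w : TypeC n).right⟩, by
    have h : (inr τ * ((w : TypeC n) * (inr (w : TypeC n).right)⁻¹) * (inr τ)⁻¹ *
        (φ w : TypeC n) : TypeC n) ∈ H :=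
      H.mul_mem (H.mul_mem (H.mul_mem (hS _) (H.mul_mem w.2 (H.inv_mem (hS _))))
        (H.inv_mem (hS _))) (φ w).2
    have e : (w : TypeC n) * (inr (w : TypeC n).right)⁻¹ = inl (w : TypeC n).left := by
      rw [mul_inv_eq_iff_eq_mul, inl_left_mul_inr_right]
    rw [e, TypeC.left_conj_inr] at h
    convert h using 1
    refine TypeC.ext' (fun i => ?_) ?_
    · rw [TypeC.mul_left_apply]; rfl
    · rw [TypeC.mul_right]; simp⟩) fun v w => by
    refine Subtype.ext (TypeC.ext' (fun i => ?_) ?_)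
    · simp only [map_mul, Subgroup.coe_mul, TypeC.mul_left_apply, hτ, mul_inv_rev,
        Perm.mul_apply, Perm.inv_def, Equiv.symm_symm, Equiv.symm_apply_apply]
      ac_rfl
    · simp only [map_mul, Subgroup.coe_mul, TypeC.mul_right]

theorem signTwist_left {H : Subgroup (TypeC n)} (hS : ∀ σ, inr σ ∈ H) {φ : H →* H}
    {τ : Perm (Fin n)} (hτ : ∀ w : H, (φ w : TypeC n).right = τ * (w : TypeC n).right * τ⁻¹)
    (w : H) (i : Fin n) : (signTwist hS φ τ hτ w : TypeC n).left i =
      (w : TypeC n).left (τ⁻¹ i) * (φ w : TypeC n).left i := rfl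

theorem signTwist_right {H : Subgroup (TypeC n)} (hS : ∀ σ, inr σ ∈ H) {φ : H →* H}
    {τ : Perm (Fin n)} (hτ : ∀ w : H, (φ w : TypeC n).right = τ * (w : TypeC n).right * τ⁻¹)
    (w : H) : (signTwist hS φ τ hτ w : TypeC n).right = (φ w : TypeC n).right := rfl

theorem exists_signTwist (H : Subgroup (TypeC n)) (hS : ∀ σ, inr σ ∈ H)
    (hz : centralInversion n ∈ H) :
    ∃ F : {φ : H →* H // IsPermInner φ} → {φ : H →* H // IsPermInner φ},
      Function.Involutive F ∧
      ∀ φ, ((F φ).1 ⟨_, hz⟩ : TypeC n) = centralInversion n * φ.1 ⟨_, hz⟩ := by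
  classical
  let T : (H → Perm (Fin n)) → Perm (Fin n) := fun r =>
    if h : ∃ τ : Perm (Fin n), ∀ w : H, r w = τ * (w : TypeC n).right * τ⁻¹ then h.choose else 1
  have hT : ∀ φ : H →* H, IsPermInner φ → ∀ w : H, (φ w : TypeC n).right =
      T (fun w => (φ w : TypeC n).right) * (w : TypeC n).right *
        (T fun w => (φ w : TypeC n).right)⁻¹ := fun φ h => by
    have e : (T fun w => (φ w : TypeC n).right) = h.choose := dif_pos h
    rw [e]
    exact h.choose_spec
  refine ⟨fun φ => ⟨signTwist hS φ.1 _ (hT φ.1 φ.2), _, hT φ.1 φ.2⟩, fun φ => ?_, fun φ => ?_⟩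
  · refine Subtype.ext (MonoidHom.ext fun w => Subtype.ext (TypeC.ext' (fun i => ?_) rfl))
    rw [signTwist_left, signTwist_left, ← mul_assoc]
    exact (congrArg (· * _) (Int.units_mul_self _)).trans (one_mul _)
  · refine TypeC.ext' (fun i => ?_) ?_
    · rw [TypeC.mul_left_apply, signTwist_left]; rfl
    · rw [TypeC.mul_right, signTwist_right]; exact (one_mul _).symm

theorem IsPermInner.map_centralInversion {H : Subgroup (TypeC n)} (hS : ∀ σ, inr σ ∈ H)
    (hz : centralInversion n ∈ H) {φ : H →* H} (hφ : IsPermInner φ) :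
    (φ ⟨_, hz⟩ : TypeC n) = 1 ∨ (φ ⟨_, hz⟩ : TypeC n) = centralInversion n := by
  obtain ⟨τ, hτ⟩ := hφ
  refine TypeC.eq_one_or_eq_centralInversion ?_ fun σ =>
    ⟨φ ⟨inr (τ⁻¹ * σ * τ), hS _⟩, ?_, ?_⟩
  · rw [hτ]; simp [centralInversion]
  · rw [hτ]; simp [mul_assoc]
  · rw [← Subgroup.coe_mul, ← Subgroup.coe_mul, ← map_mul, ← map_mul]
    refine congrArg (fun x => (φ x : TypeC n)) (Subtype.ext ?_)
    exact (centralInversion_mul_comm _).symm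

theorem card_isPermInner_map_centralInversion (H : Subgroup (TypeC n)) (hn : 0 < n)
    (hS : ∀ σ, inr σ ∈ H) (hz : centralInversion n ∈ H) :
    2 * Nat.card {φ : H →* H // IsPermInner φ ∧ φ ⟨_, hz⟩ = 1} =
      Nat.card {φ : H →* H // IsPermInner φ} := by
  obtain ⟨F, hF, hFz⟩ := exists_signTwist H hS hz
  have hz2 : centralInversion n * centralInversion n = 1 := TypeC.mul_self_of_right_eq_one rfl
  have hiff : ∀ φ : {φ : H →* H // IsPermInner φ},
      φ.1 ⟨_, hz⟩ = 1 ↔ ¬ (F φ).1 ⟨_, hz⟩ = 1 := by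
    intro φ
    simp only [Subtype.ext_iff, Subgroup.coe_one, hFz]
    rcases φ.2.map_centralInversion hS hz with h | h <;>
      simp [h, hz2, centralInversion_ne_one hn]
  let e : {φ : {φ : H →* H // IsPermInner φ} // φ.1 ⟨_, hz⟩ = 1} ≃
      {φ : {φ : H →* H // IsPermInner φ} // ¬ φ.1 ⟨_, hz⟩ = 1} :=
    (hF.toPerm).subtypeEquiv hiff
  have e1 : {φ : H →* H // IsPermInner φ ∧ φ ⟨_, hz⟩ = 1} ≃
      {φ : {φ : H →* H // IsPermInner φ} // φ.1 ⟨_, hz⟩ = 1} :=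
    (Equiv.subtypeSubtypeEquivSubtypeInter _ _).symm
  classical
  rw [← Nat.card_congr (Equiv.sumCompl
    fun φ : {φ : H →* H // IsPermInner φ} => φ.1 ⟨_, hz⟩ = 1), Nat.card_sum, ← Nat.card_congr e,
    Nat.card_congr e1, two_mul]

theorem factorial_le_card_isPermInner (H : Subgroup (TypeC n)) (hn : 3 ≤ n)
    (hS : ∀ σ, inr σ ∈ H) :
    n.factorial ≤ Nat.card {φ : H →* H // IsPermInner φ} := by
  have hcard : Nat.card (Perm (Fin n)) = n.factorial := by
    rw [Nat.card_eq_fintype_card, Fintype.card_perm, Fintype.card_fin]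
  rw [← hcard]
  refine Nat.card_le_card_of_injective
    (fun τ => ⟨(MulAut.conj (⟨inr τ, hS τ⟩ : H)).toMonoidHom, τ, fun w => ?_⟩) fun τ τ' h => ?_
  · simp [MulAut.conj_apply]
  · rw [← inv_mul_eq_one]
    refine perm_eq_one_of_forall_commute (by simpa using hn) fun σ => ?_
    have := congrArg (fun x : H => (x : TypeC n).right)
      (DFunLike.congr_fun (Subtype.ext_iff.1 h) ⟨inr σ, hS σ⟩)
    simp [MulAut.conj_apply] at this
    rw [mul_assoc, inv_mul_eq_iff_eq_mul, ← mul_assoc, ← mul_assoc, ← mul_inv_eq_iff_eq_mul, ← this]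

theorem exists_isThreeCycle (hn : 3 ≤ n) : ∃ c : Perm (Fin n), c.IsThreeCycle := by
  obtain ⟨a, b, c, hab, hac, hbc⟩ := Fintype.two_lt_card_iff.1
    (show 2 < Fintype.card (Fin n) by rw [Fintype.card_fin]; omega)
  exact ⟨_, isThreeCycle_swap_mul_swap_same hab hac hbc⟩

theorem IsThreeCycle.mul_self_ne_one {c : Perm (Fin n)} (hc : c.IsThreeCycle) : c * c ≠ 1 := by
  intro h
  have := orderOf_dvd_of_pow_eq_one (x := c) (n := 2) (by rw [pow_two, h])
  rw [hc.orderOf] at this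
  norm_num at this

theorem map_inr_eq_one_of_not_isPermInner {H : Subgroup (TypeC n)} (hn : 7 ≤ n)
    (hS : ∀ σ, inr σ ∈ H) {φ : H →* H} (hφ : ¬ IsPermInner φ) {σ : Perm (Fin n)}
    (hσ : σ ∈ alternatingGroup (Fin n)) : φ ⟨inr σ, hS σ⟩ = 1 := by
  let g : H →* Perm (Fin n) := rightHom.comp (H.subtype.comp φ)
  let ι : Perm (Fin n) →* H := (inr : Perm (Fin n) →* TypeC n).codRestrict H hS
  let K : Subgroup H := (rightHom.comp H.subtype : H →* Perm (Fin n)).ker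
  rcases alternatingGroup_le_ker_or_exists_conj (by simpa using hn) (g.comp ι) with h | ⟨τ, hτ⟩
  · have key : alternatingGroup (Fin n) ≤ (φ.comp ι).ker := by
      rw [← closure_three_cycles_eq_alternating, Subgroup.closure_le]
      intro c hc
      have h1 : (φ (ι c) : TypeC n).right = 1 := h hc.mem_alternatingGroup
      have h2 : φ (ι c) * φ (ι c) = 1 := Subtype.ext (TypeC.mul_self_of_right_eq_one h1)
      have h3 : φ (ι c) * (φ (ι c) * φ (ι c)) = 1 := by
        rw [← map_mul, ← map_mul, ← map_mul, ← map_mul, ← pow_three, ← hc.orderOf,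
          pow_orderOf_eq_one, map_one, map_one]
      rw [h2, mul_one] at h3
      exact h3
    exact key hσ
  · have hsurj : Function.Surjective g := fun σ =>
      ⟨ι (τ⁻¹ * σ * τ), (hτ _).trans (by group)⟩
    have hK : K.map g = ⊥ := by
      by_contra hne
      have : (K.map g).Normal := Subgroup.Normal.map inferInstance g hsurj
      have hle := alternatingGroup_le_of_normal (N := K.map g) (by simpa using by omega)
        (Subgroup.nontrivial_iff_ne_bot _ |>.2 hne)
      obtain ⟨c, hc⟩ := exists_isThreeCycle (n := n) (by omega)
      obtain ⟨k, hk, rfl⟩ := hle hc.mem_alternatingGroup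
      refine IsThreeCycle.mul_self_ne_one hc ?_
      have : k * k = 1 := Subtype.ext (TypeC.mul_self_of_right_eq_one hk)
      rw [← map_mul, this, map_one]
    refine absurd ⟨τ, fun w => ?_⟩ hφ
    have hw : w * (ι (w : TypeC n).right)⁻¹ ∈ K := by
      change (w : TypeC n).right * _ = 1
      simp [ι]
    have h1 : g (w * (ι (w : TypeC n).right)⁻¹) = 1 := by
      rw [← Subgroup.mem_bot, ← hK]
      exact ⟨_, hw, rfl⟩
    rw [map_mul, map_inv, mul_inv_eq_one] at h1
    exact h1.trans (hτ _)

theorem card_not_isPermInner_le (H : Subgroup (TypeC n)) (hn : 7 ≤ n) (hS : ∀ σ, inr σ ∈ H)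
    {a b : Fin n} (hab : a ≠ b) {u : Fin n → ℤˣ} (hu : inl u ∈ H) (hab_u : u a = u b)
    (hgen : ∀ K : Subgroup (TypeC n), (∀ σ, inr σ ∈ K) → inl u ∈ K → H ≤ K) :
    Nat.card {φ : H →* H // ¬ IsPermInner φ} ≤
      4 ^ n * (commInvolPairs (Finset.univ : Finset (Fin n))).card := by
  let x : H := ⟨inl u, hu⟩
  let s : H := ⟨inr (swap a b), hS _⟩
  have hxx : x * x = 1 := Subtype.ext (TypeC.mul_self_of_right_eq_one rfl)
  have hss : s * s = 1 := Subtype.ext (by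
    change (inr (swap a b) * inr (swap a b) : TypeC n) = 1
    rw [← map_mul, swap_mul_self, map_one])
  have hxs : x * s = s * x := Subtype.ext (by
    change (inl u * inr (swap a b) : TypeC n) = inr (swap a b) * inl u
    refine TypeC.ext' (fun i => ?_) ?_
    · rw [TypeC.mul_left_apply, TypeC.mul_left_apply]
      simp only [left_inl, left_inr, right_inl, right_inr, Pi.one_apply, mul_one, one_mul, swap_inv]
      rcases eq_or_ne i a with rfl | hia
      · rw [swap_apply_left, hab_u]
      · rcases eq_or_ne i b with rfl | hib
        · rw [swap_apply_right, hab_u]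
        · rw [swap_apply_of_ne_of_ne hia hib]
    · rw [TypeC.mul_right, TypeC.mul_right]; simp)
  let P := {p : Perm (Fin n) × Perm (Fin n) // p ∈ commInvolPairs (Finset.univ : Finset (Fin n))}
  let f : {φ : H →* H // ¬ IsPermInner φ} → ((Fin n → ℤˣ) × (Fin n → ℤˣ)) × P := fun φ =>
    (((φ.1 x : TypeC n).left, (φ.1 s : TypeC n).left),
      ⟨((φ.1 x : TypeC n).right, (φ.1 s : TypeC n).right), by
        simp only [commInvolPairs, Finset.mem_filter_univ, ← TypeC.mul_right, ← Subgroup.coe_mul,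
          ← map_mul, hxx, hss, hxs]
        simp⟩)
  have hf : Function.Injective f := by
    rintro ⟨φ, hφ⟩ ⟨ψ, hψ⟩ h
    simp only [f, Prod.mk.injEq] at h
    obtain ⟨⟨h1, h2⟩, h⟩ := h
    obtain ⟨h3, h4⟩ := Prod.mk.inj (Subtype.ext_iff.1 h)
    have hx : φ x = ψ x := Subtype.ext (SemidirectProduct.ext h1 h3)
    have hs : φ s = ψ s := Subtype.ext (SemidirectProduct.ext h2 h4)
    refine Subtype.ext ?_
    have hle := hgen ((φ.eqLocus ψ).map H.subtype) (fun σ => ?_) ⟨x, hx, rfl⟩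
    · ext1 w
      obtain ⟨w', hw', hww'⟩ := hle w.2
      exact (Subtype.ext hww' : w' = w) ▸ hw'
    · refine ⟨⟨inr σ, hS σ⟩, ?_, rfl⟩
      change φ _ = ψ _
      rcases Int.units_eq_one_or (sign σ) with hσ | hσ
      · rw [map_inr_eq_one_of_not_isPermInner hn hS hφ (mem_alternatingGroup.2 hσ),
          map_inr_eq_one_of_not_isPermInner hn hS hψ (mem_alternatingGroup.2 hσ)]
      · have hmem : swap a b * σ ∈ alternatingGroup (Fin n) := by
          rw [mem_alternatingGroup, map_mul, hσ, sign_swap hab]; rfl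
        have e : (⟨inr σ, hS σ⟩ : H) = s * ⟨inr (swap a b * σ), hS _⟩ := Subtype.ext (by
          change (inr σ : TypeC n) = inr (swap a b) * inr (swap a b * σ)
          rw [← map_mul, swap_mul_self_mul])
        rw [e, φ.map_mul, ψ.map_mul, hs, map_inr_eq_one_of_not_isPermInner hn hS hφ hmem,
          map_inr_eq_one_of_not_isPermInner hn hS hψ hmem]
  refine (Nat.card_le_card_of_injective f hf).trans (le_of_eq ?_)
  rw [Nat.card_prod, Nat.card_prod, Nat.card_fun, Nat.card_eq_fintype_card (α := ℤˣ),
    Fintype.card_units_int, Nat.card_fin, ← mul_pow, Nat.card_eq_fintype_card, Fintype.card_coe]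
  norm_num

theorem abs_probCenterLeKer_sub_half_le (H : Subgroup (TypeC n)) (hn : 7 ≤ n)
    (hS : ∀ σ, inr σ ∈ H) (hz : centralInversion n ∈ H)
    {a b : Fin n} (hab : a ≠ b) {u : Fin n → ℤˣ} (hu : inl u ∈ H) (hab_u : u a = u b)
    (hgen : ∀ K : Subgroup (TypeC n), (∀ σ, inr σ ∈ K) → inl u ∈ K → H ≤ K) :
    |probCenterLeKer H - 1 / 2| ≤
      4 ^ n * (commInvolPairs (Finset.univ : Finset (Fin n))).card / n.factorial := by
  have hker : ∀ φ : H →* H, Subgroup.center H ≤ φ.ker ↔ φ ⟨_, hz⟩ = 1 := by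
    refine fun φ => ⟨fun h => h ?_, fun h x hx => ?_⟩
    · exact Subgroup.mem_center_iff.2 fun w => Subtype.ext (centralInversion_mul_comm _).symm
    · rcases TypeC.eq_of_mem_center (by omega) hS hx with h1 | h1
      · rw [show x = 1 from Subtype.ext h1]; exact map_one φ
      · rw [show x = ⟨_, hz⟩ from Subtype.ext h1]; exact h
  classical
  have htotal : Nat.card (H →* H) = Nat.card {φ : H →* H // IsPermInner φ} +
      Nat.card {φ : H →* H // ¬ IsPermInner φ} := by
    rw [← Nat.card_sum, Nat.card_congr (Equiv.sumCompl fun φ : H →* H => IsPermInner φ)]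
  have hkill : Nat.card {φ : H →* H // Subgroup.center H ≤ φ.ker} =
      Nat.card {φ : H →* H // IsPermInner φ ∧ φ ⟨_, hz⟩ = 1} +
      Nat.card {φ : H →* H // ¬ IsPermInner φ ∧ φ ⟨_, hz⟩ = 1} := by
    simp only [hker]
    rw [← Nat.card_congr (Equiv.sumCompl
      fun φ : {φ : H →* H // φ ⟨_, hz⟩ = 1} => IsPermInner φ.1), Nat.card_sum]
    congr 1
    · exact Nat.card_congr ((Equiv.subtypeSubtypeEquivSubtypeInter _ _).trans
        (Equiv.subtypeEquivRight fun _ => and_comm))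
    · exact Nat.card_congr ((Equiv.subtypeSubtypeEquivSubtypeInter _
        fun φ : H →* H => ¬ IsPermInner φ).trans (Equiv.subtypeEquivRight fun _ => and_comm))
  have hsub : Nat.card {φ : H →* H // ¬ IsPermInner φ ∧ φ ⟨_, hz⟩ = 1} ≤
      Nat.card {φ : H →* H // ¬ IsPermInner φ} :=
    Nat.card_le_card_of_injective (fun φ => ⟨φ.1, φ.2.1⟩)
      fun _ _ h => Subtype.ext (by simpa using h)
  have hhalf := card_isPermInner_map_centralInversion H (by omega) hS hz
  have hbig := factorial_le_card_isPermInner H (by omega) hS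
  have hsmall := card_not_isPermInner_le H hn hS hab hu hab_u hgen
  have hfac : (0 : ℝ) < n.factorial := by positivity
  rw [probCenterLeKer, htotal, hkill, ← hhalf]
  rw [← hhalf] at hbig
  generalize Nat.card {φ : H →* H // IsPermInner φ ∧ φ ⟨_, hz⟩ = 1} = B at *
  generalize Nat.card {φ : H →* H // ¬ IsPermInner φ} = S at *
  generalize Nat.card {φ : H →* H // ¬ IsPermInner φ ∧ φ ⟨_, hz⟩ = 1} = S' at *
  generalize (commInvolPairs (Finset.univ : Finset (Fin n))).card = h at *
  have hbig' : (n.factorial : ℝ) ≤ 2 * B := by exact_mod_cast hbig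
  have hsmall' : (S : ℝ) ≤ 4 ^ n * h := by exact_mod_cast hsmall
  have hsub' : (S' : ℝ) ≤ S := by exact_mod_cast hsub
  have hS0 : (0 : ℝ) ≤ S := by positivity
  have hS'0 : (0 : ℝ) ≤ S' := by positivity
  have hB : (0 : ℝ) < 2 * B + S := by linarith
  push_cast
  have e : ((B : ℝ) + S') / (2 * B + S) - 1 / 2 = (S' - S / 2) / (2 * B + S) := by
    rw [div_sub_div _ _ hB.ne' two_ne_zero, div_eq_div_iff (by positivity) hB.ne']; ring
  rw [e, abs_div, abs_of_pos hB]
  refine div_le_div₀ (by positivity) (le_trans ?_ hsmall') hfac (by linarith)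
  rw [abs_le]
  constructor <;> linarith

end SignedPermutations

section Limits

open SemidirectProduct Equiv Equiv.Perm

theorem card_commInvolPairs_div_factorial_le {n : ℕ} (hn : 400000 ≤ n) :
    4 ^ n * ((commInvolPairs (Finset.univ : Finset (Fin n))).card : ℝ) / n.factorial ≤
      (1 / 2) ^ n := by
  obtain ⟨L, hL⟩ : ∃ L, L = n / 24 := ⟨_, rfl⟩
  have h1 : 24 * L ≤ n := by omega
  have h2 : n ≤ 25 * L := by omega
  have h3 : 15701 ≤ L := by omega
  have hcard := card_commInvolPairs_le (α := Fin n) (L := L) (by omega) (by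
    rw [Fintype.card_fin]
    calc L ^ 3 + 3 * n * L ^ 2 + n ^ 3 ≤ L ^ 3 + 3 * (25 * L) * L ^ 2 + (25 * L) ^ 3 := by gcongr
      _ = 15701 * L ^ 3 := by ring
      _ ≤ L * L ^ 3 := Nat.mul_le_mul_right _ h3
      _ = L ^ 4 := by ring) Finset.univ
  rw [Finset.card_univ, Fintype.card_fin] at hcard
  have hcard' : ((commInvolPairs (Finset.univ : Finset (Fin n))).card : ℝ) ≤ (L : ℝ) ^ n := by
    exact_mod_cast hcard
  have hfac : (0 : ℝ) < n.factorial := by positivity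
  have hexp : (n : ℝ) ^ n ≤ 3 ^ n * n.factorial := by
    have := Real.pow_div_factorial_le_exp (x := (n : ℝ)) (by positivity) n
    rw [div_le_iff₀ hfac] at this
    refine this.trans (mul_le_mul_of_nonneg_right ?_ hfac.le)
    rw [← mul_one (n : ℝ), Real.exp_nat_mul]
    exact pow_le_pow_left₀ (Real.exp_pos _).le (Real.exp_one_lt_d9.le.trans (by norm_num)) n
  rw [div_le_iff₀ hfac]
  have hL' : 4 * (L : ℝ) ≤ n / 6 := by
    have : (24 : ℝ) * L ≤ n := by exact_mod_cast h1
    linarith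
  calc 4 ^ n * ((commInvolPairs (Finset.univ : Finset (Fin n))).card : ℝ)
      ≤ 4 ^ n * (L : ℝ) ^ n := by gcongr
    _ = (4 * (L : ℝ)) ^ n := (mul_pow _ _ _).symm
    _ ≤ (n / 6) ^ n := by gcongr
    _ = (1 / 6) ^ n * n ^ n := by rw [← mul_pow]; ring
    _ ≤ (1 / 6) ^ n * (3 ^ n * n.factorial) := by gcongr
    _ = (1 / 2) ^ n * n.factorial := by rw [← mul_assoc, ← mul_pow]; norm_num

theorem probCenterLeKer_congr {G H : Type} [Group G] [Group H] [Finite G] [Finite H]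
    (e : G ≃* H) : probCenterLeKer G = probCenterLeKer H := by
  let E : (G →* G) ≃ (H →* H) :=
    { toFun := fun φ => e.toMonoidHom.comp (φ.comp e.symm.toMonoidHom)
      invFun := fun φ => e.symm.toMonoidHom.comp (φ.comp e.toMonoidHom)
      left_inv := fun φ => by ext; simp
      right_inv := fun φ => by ext; simp }
  have hE : ∀ φ : G →* G, Subgroup.center G ≤ φ.ker ↔ Subgroup.center H ≤ (E φ).ker := by
    intro φ
    have hφ : ∀ x, E φ x = e (φ (e.symm x)) := fun _ => rfl
    constructor
    · intro h x hx
      have : e.symm x ∈ Subgroup.center G := by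
        rw [Subgroup.mem_center_iff] at hx ⊢
        intro g
        apply e.injective
        simpa using hx (e g)
      rw [MonoidHom.mem_ker, hφ, MonoidHom.mem_ker.1 (h this), map_one]
    · intro h x hx
      have : e x ∈ Subgroup.center H := by
        rw [Subgroup.mem_center_iff] at hx ⊢
        intro g
        apply e.symm.injective
        simpa using hx (e.symm g)
      have h1 := MonoidHom.mem_ker.1 (h this)
      rw [hφ, e.symm_apply_apply, map_eq_one_iff e e.injective] at h1
      exact h1
  rw [probCenterLeKer, probCenterLeKer, Nat.card_congr E,
    Nat.card_congr (E.subtypeEquiv (q := fun ψ => Subgroup.center H ≤ ψ.ker) hE)]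

theorem probCenterLeKer_eq_one {G : Type} [Group G] [Finite G] (h : Subgroup.center G = ⊥) :
    probCenterLeKer G = 1 := by
  have : Finite (G →* G) := DFunLike.finite _
  rw [probCenterLeKer, Nat.card_congr (Equiv.subtypeUnivEquiv fun φ => by rw [h]; exact bot_le)]
  exact div_self (Nat.cast_ne_zero.2 Nat.card_pos.ne')

theorem center_typeA_eq_bot {n : ℕ} (hn : 2 ≤ n) : Subgroup.center (TypeA n) = ⊥ := by
  refine (Subgroup.eq_bot_iff_forall _).2 fun τ hτ => ?_
  exact perm_eq_one_of_forall_commute (by rw [Fintype.card_fin]; omega) fun σ =>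
    (Subgroup.mem_center_iff.1 hτ σ).symm

theorem inversionSign_inl {n : ℕ} (u : Fin n → ℤˣ) : inversionSign n (inl u) = ∏ i, u i := rfl

theorem inr_mem_ker_inversionSign {n : ℕ} (σ : Perm (Fin n)) :
    (inr σ : TypeC n) ∈ (inversionSign n).ker := by
  change ∏ i, (1 : Fin n → ℤˣ) i = 1
  simp

theorem inversionSign_centralInversion (n : ℕ) :
    inversionSign n (centralInversion n) = (-1) ^ n := by
  rw [centralInversion, inversionSign_inl]; simp

theorem center_typeD_eq_bot {n : ℕ} (hn : 1 ≤ n) :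
    Subgroup.center (TypeD (2 * n + 1)) = ⊥ := by
  refine (Subgroup.eq_bot_iff_forall _).2 fun x hx => ?_
  rcases TypeC.eq_of_mem_center (by omega) inr_mem_ker_inversionSign hx with h | h
  · exact Subtype.ext h
  · have := MonoidHom.mem_ker.1 x.2
    rw [h, inversionSign_centralInversion, pow_succ, pow_mul] at this
    simp at this

theorem inl_mulSingle_conj {n : ℕ} (σ : Perm (Fin n)) (i : Fin n) (x : ℤˣ) :
    (inr σ * inl (Pi.mulSingle i x) * (inr σ)⁻¹ : TypeC n) = inl (Pi.mulSingle (σ i) x) := by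
  rw [TypeC.left_conj_inr]
  congr 1
  ext1 j
  by_cases h : j = σ i
  · subst h; simp
  · rw [Pi.mulSingle_eq_of_ne h, Pi.mulSingle_eq_of_ne]
    rintro rfl
    simp at h

theorem eq_top_of_inr_mem_of_inl_mulSingle_mem {n : ℕ} {K : Subgroup (TypeC n)}
    (hS : ∀ σ, inr σ ∈ K) {c : Fin n} (hc : inl (Pi.mulSingle c (-1)) ∈ K) : K = ⊤ := by
  have hsingle : ∀ (i : Fin n) (x : ℤˣ), (inl (Pi.mulSingle i x) : TypeC n) ∈ K := by
    intro i x
    rcases Int.units_eq_one_or x with rfl | rfl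
    · simp [K.one_mem]
    · have := K.mul_mem (K.mul_mem (hS (swap c i)) hc) (K.inv_mem (hS (swap c i)))
      rwa [inl_mulSingle_conj, swap_apply_left] at this
  refine (Subgroup.eq_top_iff' K).2 fun w => ?_
  rw [← inl_left_mul_inr_right w]
  refine K.mul_mem ?_ (hS _)
  rw [← Finset.univ_prod_mulSingle w.left]
  exact Subgroup.prod_mem (K.comap inl) fun i _ => hsingle i _

theorem ker_inversionSign_le {n : ℕ} {K : Subgroup (TypeC n)} (hS : ∀ σ, inr σ ∈ K)
    {c d : Fin n} (hcd : c ≠ d)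
    (hc : inl (Pi.mulSingle c (-1) * Pi.mulSingle d (-1)) ∈ K) : (inversionSign n).ker ≤ K := by
  have hpair : ∀ (i : Fin n) (x : ℤˣ),
      (inl (Pi.mulSingle i x * Pi.mulSingle d x) : TypeC n) ∈ K := by
    intro i x
    rcases Int.units_eq_one_or x with rfl | rfl
    · simp [K.one_mem]
    · rcases eq_or_ne i d with rfl | hid
      · rw [← Pi.mulSingle_mul]; simp [K.one_mem]
      · have := K.mul_mem (K.mul_mem (hS (swap c i)) hc) (K.inv_mem (hS (swap c i)))
        have e : (inr (swap c i) * inl (Pi.mulSingle c (-1) * Pi.mulSingle d (-1)) *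
            (inr (swap c i))⁻¹ : TypeC n) = inl (Pi.mulSingle i (-1) * Pi.mulSingle d (-1)) := by
          rw [map_mul, ← conj_mul, inl_mulSingle_conj, inl_mulSingle_conj, swap_apply_left,
            swap_apply_of_ne_of_ne hcd.symm hid.symm, map_mul]
        rwa [e] at this
  let F : (Fin n → ℤˣ) →* (Fin n → ℤˣ) :=
    MonoidHom.id _ * (MonoidHom.mulSingle (fun _ : Fin n => ℤˣ) d).comp
      { toFun := fun u => ∏ i, u i, map_one' := by simp,
        map_mul' := fun u v => Finset.prod_mul_distrib }
  have hF : ∀ u, F u = u * Pi.mulSingle d (∏ i, u i) := fun u => rfl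
  intro w hw
  rw [← inl_left_mul_inr_right w]
  refine K.mul_mem ?_ (hS _)
  have hprod : ∏ i, w.left i = 1 := hw
  have : F w.left = w.left := by rw [hF, hprod, Pi.mulSingle_one, mul_one]
  rw [← this, ← Finset.univ_prod_mulSingle w.left]
  refine Subgroup.prod_mem ((K.comap inl).comap F) fun i _ => ?_
  rw [Subgroup.mem_comap, hF, Subgroup.mem_comap]
  convert hpair i (w.left i) using 3
  rw [Finset.prod_pi_mulSingle']
  simp

theorem abs_probCenterLeKer_typeC_sub_half_le {n : ℕ} (hn : 400000 ≤ n) :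
    |probCenterLeKer (TypeC n) - 1 / 2| ≤ (1 / 2) ^ n := by
  rw [← probCenterLeKer_congr (Subgroup.topEquiv : (⊤ : Subgroup (TypeC n)) ≃* TypeC n)]
  let a : Fin n := ⟨0, by omega⟩
  let b : Fin n := ⟨1, by omega⟩
  let c : Fin n := ⟨2, by omega⟩
  have hab : a ≠ b := by simp [a, b]
  have hac : a ≠ c := by simp [a, c]
  have hbc : b ≠ c := by simp [b, c]
  refine (abs_probCenterLeKer_sub_half_le (⊤ : Subgroup (TypeC n)) (by omega) (fun _ => trivial)
    trivial hab (u := Pi.mulSingle c (-1)) trivial ?_ fun K hK hc => ?_).trans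
    (card_commInvolPairs_div_factorial_le hn)
  · rw [Pi.mulSingle_eq_of_ne hac, Pi.mulSingle_eq_of_ne hbc]
  · exact (eq_top_of_inr_mem_of_inl_mulSingle_mem hK hc).ge

theorem abs_probCenterLeKer_typeD_sub_half_le {n : ℕ} (hn : 400000 ≤ n) (heven : Even n) :
    |probCenterLeKer (TypeD n) - 1 / 2| ≤ (1 / 2) ^ n := by
  let a : Fin n := ⟨0, by omega⟩
  let b : Fin n := ⟨1, by omega⟩
  let c : Fin n := ⟨2, by omega⟩
  let d : Fin n := ⟨3, by omega⟩
  have hab : a ≠ b := by simp [a, b]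
  have hac : a ≠ c := by simp [a, c]
  have hbc : b ≠ c := by simp [b, c]
  have had : a ≠ d := by simp [a, d]
  have hbd : b ≠ d := by simp [b, d]
  have hcd : c ≠ d := by simp [c, d]
  refine (abs_probCenterLeKer_sub_half_le (inversionSign n).ker (by omega)
    inr_mem_ker_inversionSign ?_ hab (u := Pi.mulSingle c (-1) * Pi.mulSingle d (-1)) ?_ ?_
    fun K hK hc => ker_inversionSign_le hK hcd hc).trans
    (card_commInvolPairs_div_factorial_le hn)
  · rw [MonoidHom.mem_ker, inversionSign_centralInversion, heven.neg_one_pow]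
  · rw [MonoidHom.mem_ker, inversionSign_inl]
    simp only [Pi.mul_apply, Finset.prod_mul_distrib, Finset.prod_pi_mulSingle']
    simp
  · simp [Pi.mulSingle_eq_of_ne, hac, hbc, had, hbd]

theorem tendsto_half_of_abs_sub_le {p : ℕ → ℝ} {k : ℕ → ℕ} (hk : Tendsto k atTop atTop)
    (h : ∀ᶠ n in atTop, |p n - 1 / 2| ≤ (1 / 2) ^ k n) : Tendsto p atTop (𝓝 (1 / 2)) := by
  rw [tendsto_iff_norm_sub_tendsto_zero]
  have h0 : Tendsto (fun n => (1 / 2 : ℝ) ^ k n) atTop (𝓝 0) :=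
    (tendsto_pow_atTop_nhds_zero_of_lt_one (by norm_num) (by norm_num)).comp hk
  exact squeeze_zero' (Eventually.of_forall fun _ => norm_nonneg _) h h0

end Limits

theorem theorem5 :
    Tendsto (fun n : ℕ => probCenterLeKer (TypeC n)) atTop (𝓝 (1 / 2)) ∧
    Tendsto (fun n : ℕ => probCenterLeKer (TypeD (2 * n))) atTop (𝓝 (1 / 2)) ∧
    Tendsto (fun n : ℕ => probCenterLeKer (TypeD (2 * n + 1))) atTop (𝓝 1) ∧
    Tendsto (fun n : ℕ => probCenterLeKer (TypeA n)) atTop (𝓝 1) ∧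
    (∀ n : ℕ, 1 ≤ n → Subgroup.center (TypeD (2 * n + 1)) = ⊥) ∧
    (∀ n : ℕ, 2 ≤ n → Subgroup.center (TypeA n) = ⊥) := by
  refine ⟨?_, ?_, ?_, ?_, fun n hn => center_typeD_eq_bot hn, fun n hn => center_typeA_eq_bot hn⟩
  · refine tendsto_half_of_abs_sub_le tendsto_id ?_
    filter_upwards [eventually_ge_atTop 400000] with n hn
    exact abs_probCenterLeKer_typeC_sub_half_le hn
  · refine tendsto_half_of_abs_sub_le (k := fun n => 2 * n)
      (tendsto_atTop_mono (fun n => by simp only [id]; omega) tendsto_id) ?_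
    filter_upwards [eventually_ge_atTop 400000] with n hn
    exact abs_probCenterLeKer_typeD_sub_half_le (by omega) (even_two_mul n)
  · refine tendsto_const_nhds.congr' ?_
    filter_upwards [eventually_ge_atTop 1] with n hn
    exact (probCenterLeKer_eq_one (center_typeD_eq_bot hn)).symm
  · refine tendsto_const_nhds.congr' ?_
    filter_upwards [eventually_ge_atTop 2] with n hn
    exact (probCenterLeKer_eq_one (center_typeA_eq_bot hn)).symm
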